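/- Let $k$ be a field, $M$ a matroid on $[n]=\{1,\dots,n\}$ with dual matroid $M^\perp$, and $W\subseteq k^{n}$ a linear realization of $M$: a linear subspace such that, for $B\subseteq[n]$, the coordinate projection $W\to k^{B}$ is an isomorphism if and only if $B$ is a basis of $M$. Let $W^\perp=\{q\in k^n:\sum_i p_iq_i=0\text{ for all }p\in W\}$, let $S=k[W\times W^\perp]=k[W]\otimes_k k[W^\perp]=\operatorname{Sym}\big((W\times W^\perp)^*\big)$ (a polynomial ring in $n$ variables), and let $f_i,g_i\in S$ be the linear forms $f_i(p,q)=p_i$ and $g_i(p,q)=q_i$. Let $\mathfrak a=(f_1g_1,\dots,f_ng_n)\subseteq S$ be the ideal of pairs. For $I,J\subseteq[n]$ put $\mathfrak p_{I,J}=(f_i: i\in I)+(g_j: j\in J)$ and let $L_{I,J}=V(\mathfrak p_{I,J})$, whose $k$-points are the linear subspace $\{(p,q)\in W\times W^\perp: p_i=0\ (i\in I),\ q_j=0\ (j\in J)\}$. A biflat is a pair $(F,G)$ with $F$ a flat of $M$, $G$ a flat of $M^\perp$ and $F\cup G=[n]$. A flat of $M$ is cyclic if it is a union of circuits of $M$.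 Write $F^c=[n]\setminus F$. (a) Every associated prime of $S/\mathfrak a$ is equal to $\mathfrak p_{F,G}$ for some biflat $(F,G)$. (b) The set of minimal primes of $S/\mathfrak a$ (that is, of primes of $S$ minimal over $\mathfrak a$) is $\{\mathfrak p_{F,F^c}: F\text{ a cyclic flat of }M\}$. In particular, $V(\mathfrak a)=\bigcup_{F} L_{F,F^c}$, the union being over the cyclic flats $F$ of $M$; this holds both in $\operatorname{Spec}S$ and on $k$-points, i.e. as subsets of $W\times W^\perp$. (c) The ideal $\mathfrak a$ has a minimal (irredundant) primary decomposition, and for every cyclic flat $F$ of $M$, in every minimal primary decomposition of $\mathfrak a$, the primary component whose radical is $\mathfrak p_{F,F^c}$ occurs and is $\mathfrak p_{F,F^c}$ itself. -/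

import Mathlib

namespace IdealOfPairs

noncomputable section

variable {k : Type*} [Field k] {n : ℕ}

/-- `W` is a linear realization of the matroid `M` on the ground set `[n]`: the composite
`W → k^[n] → k^B` is an isomorphism if and only if `B` is a basis of `M`. -/
structure Realizes (W : Submodule k (Fin n → k)) (M : Matroid (Fin n)) : Prop where
  ground_eq : M.E = Set.univ
  isBase_iff : ∀ B : Set (Fin n),
    M.IsBase B ↔ Function.Bijective (fun (w : W) (b : B) => (w : Fin n → k) b)

/-- `W^⊥ = (k^[n] / W)^*`, the annihilator of `W`, viewed inside `k^[n]` through the standard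
identification of `k^[n]` with its dual. -/
def perp (W : Submodule k (Fin n → k)) : Submodule k (Fin n → k) where
  carrier := {q | ∀ p ∈ W, ∑ i, p i * q i = 0}
  add_mem' := by
    intro a b ha hb p hp
    simp [mul_add, Finset.sum_add_distrib, ha p hp, hb p hp]
  zero_mem' := by
    intro p _
    simp
  smul_mem' := by
    intro c q hq p hp
    have h := hq p hp
    have : ∑ i, p i * (c • q) i = c * ∑ i, p i * q i := by
      rw [Finset.mul_sum]
      exact Finset.sum_congr rfl fun i _ => by simp [mul_left_comm]
    rw [this, h, mul_zero]

/-- The coordinate ring `S = k[W] ⊗ k[W^⊥] = k[W × W^⊥]`, that is, the symmetric algebra of the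
dual space of `W × W^⊥`. It is a polynomial ring in `n` variables over `k`. -/
abbrev CoordRing (W : Submodule k (Fin n → k)) : Type _ :=
  SymmetricAlgebra k (Module.Dual k (W × perp W))

/-- The linear functional `(p, q) ↦ p i` on `W × W^⊥`. -/
def fstCoord (W : Submodule k (Fin n → k)) (i : Fin n) : Module.Dual k (W × perp W) :=
  LinearMap.proj i ∘ₗ W.subtype ∘ₗ LinearMap.fst k W (perp W)

/-- The linear functional `(p, q) ↦ q i` on `W × W^⊥`. -/
def sndCoord (W : Submodule k (Fin n → k)) (i : Fin n) : Module.Dual k (W × perp W) :=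
  LinearMap.proj i ∘ₗ (perp W).subtype ∘ₗ LinearMap.snd k W (perp W)

/-- `f_i ∈ S`, the restriction to `W` of the `i`-th coordinate function. -/
def f (W : Submodule k (Fin n → k)) (i : Fin n) : CoordRing W :=
  SymmetricAlgebra.ι k _ (fstCoord W i)

/-- `g_i ∈ S`, the restriction to `W^⊥` of the `i`-th coordinate function. -/
def g (W : Submodule k (Fin n → k)) (i : Fin n) : CoordRing W :=
  SymmetricAlgebra.ι k _ (sndCoord W i)

/-- The ideal of pairs `(f_1 g_1, …, f_n g_n)`. -/
def pairs (W : Submodule k (Fin n → k)) : Ideal (CoordRing W) :=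
  Ideal.span (Set.range fun i => f W i * g W i)

/-- The linear ideal `p_{I,J} = (f_i : i ∈ I) + (g_j : j ∈ J)`. -/
def linIdeal (W : Submodule k (Fin n → k)) (I J : Set (Fin n)) : Ideal (CoordRing W) :=
  Ideal.span (f W '' I) ⊔ Ideal.span (g W '' J)

/-- A biflat of `M`: a flat `F` of `M` and a flat `G` of the dual matroid with `F ∪ G = [n]`. -/
structure IsBiflat (M : Matroid (Fin n)) (F G : Set (Fin n)) : Prop where
  isFlat_left : M.IsFlat F
  isFlat_right : M✶.IsFlat G
  union_eq : F ∪ G = Set.univ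

/-- A cyclic flat of `M`: a flat that is a union of circuits. -/
structure IsCyclicFlat (M : Matroid (Fin n)) (F : Set (Fin n)) : Prop where
  isFlat : M.IsFlat F
  union_circuits : ∃ 𝒞 : Set (Set (Fin n)), (∀ C ∈ 𝒞, M.IsCircuit C) ∧ F = ⋃₀ 𝒞

/-- Evaluation of an element of `S` at a point of `W × W^⊥`. -/
def evalAt (W : Submodule k (Fin n → k)) (x : W × perp W) : CoordRing W →ₐ[k] k :=
  SymmetricAlgebra.lift (Module.Dual.eval k (W × perp W) x)

/-- The `k`-points of `V(𝔟)` in the affine space `W × W^⊥`. -/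
def pointLocus (W : Submodule k (Fin n → k)) (𝔟 : Ideal (CoordRing W)) : Set (W × perp W) :=
  {x | ∀ s ∈ 𝔟, evalAt W x s = 0}

/-- The linear subspace `L_{I,J}` of `W × W^⊥` given by `p i = 0` for `i ∈ I` and `q j = 0` for
`j ∈ J`. -/
def linSubspace (W : Submodule k (Fin n → k)) (I J : Set (Fin n)) : Submodule k (W × perp W) :=
  (⨅ i ∈ I, LinearMap.ker (fstCoord W i)) ⊓ (⨅ j ∈ J, LinearMap.ker (sndCoord W j))

/-- `L_{I,J}` is the zero locus of `p_{I,J}`. -/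
theorem pointLocus_linIdeal (W : Submodule k (Fin n → k)) (I J : Set (Fin n)) :
    pointLocus W (linIdeal W I J) = linSubspace W I J := by
  ext x
  have key : x ∈ pointLocus W (linIdeal W I J) ↔
      linIdeal W I J ≤ RingHom.ker (evalAt W x) := Iff.rfl
  rw [key, linIdeal, sup_le_iff, Ideal.span_le, Ideal.span_le]
  simp [Set.subset_def, linSubspace, f, g, evalAt, RingHom.mem_ker]

end

end IdealOfPairs

/-!
For a prime `P` containing `𝔞 = pairs W`, put `I = {i | f i ∈ P}` and `J = {j | g j ∈ P}`, so
that `I ∪ J = [n]`. After inverting the `f i` and `g i` outside `P`, the ideal `𝔞` becomes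
`𝔟 = (f i : i ∉ J) + (g i : i ∉ I) + (f i * g i : i ∈ I ∩ J)`, which is extended from the polynomial
subring `R = k[f i, g j : i ∈ I, j ∈ J]`. Since `S` is a polynomial ring over `R`, the module
`S ⧸ 𝔟` is torsion-free over the polynomial ring over `k` in the remaining variables. Hence a
proper colon ideal `𝔟 : y` containing the irrelevant ideal of `R` is generated by it, and so an
associated prime `P` of `𝔞` equals `p_{I,J}`.

Membership of `f i` in `p_{I,J}` is membership of `i` in the closure of `I` in `M`, and likewise for
`g i` in the dual, so `I` and `J` are flats. If `P` is minimal it equals both `p_{I,Iᶜ}` and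
`p_{Jᶜ,J}`, and an element `e ∈ I ∩ J` would lie in the closure of `I \ {e}` and in the dual closure
of `Iᶜ`, which is impossible; thus `J = Iᶜ`, and this is a flat of the dual exactly when the flat
`I` is cyclic. At such a prime `𝔞` and `p_{I,Iᶜ}` agree after inverting an element outside the
prime, which determines the primary component.
-/

namespace IdealOfPairs

section Matroid

open Matroid

variable {α : Type*} {M : Matroid α}

theorem mem_closure_dual_iff {X : Set α} {e : α} (he : e ∈ M.E) (heX : e ∉ X) :
    e ∈ M✶.closure X ↔ e ∉ M.closure ((M.E \ X) \ {e}) := by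
  have h : (M✶ ／ X).IsLoop e ↔ (M ＼ X).IsColoop e := by
    rw [← dual_delete, dual_isLoop_iff_isColoop]
  rw [contract_isLoop_iff_mem_closure, delete_isColoop_iff] at h
  simpa [he, heX] using h

theorem isFlat_dual_diff_iff {F : Set α} (hF : F ⊆ M.E) :
    M✶.IsFlat (M.E \ F) ↔ ∀ e ∈ F, e ∈ M.closure (F \ {e}) := by
  have hdual {e : α} (he : e ∈ F) : e ∈ M✶.closure (M.E \ F) ↔ e ∉ M.closure (F \ {e}) := by
    rw [mem_closure_dual_iff (hF he) (fun h => h.2 he), Set.sdiff_sdiff_cancel_left hF]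
  rw [isFlat_iff_closure_eq]
  refine ⟨fun h e he => ?_, fun h => ?_⟩
  · by_contra hcl
    exact (h.le ((hdual he).mpr hcl)).2 he
  · refine Set.Subset.antisymm (fun e he => ⟨M✶.mem_ground_of_mem_closure he, fun heF => ?_⟩)
      (M✶.subset_closure _ Set.sdiff_subset)
    exact (hdual heF).mp he (h e heF)

theorem exists_eq_sUnion_isCircuit_iff {F : Set α} :
    (∃ 𝒞 : Set (Set α), (∀ C ∈ 𝒞, M.IsCircuit C) ∧ F = ⋃₀ 𝒞) ↔
      ∀ e ∈ F, e ∈ M.closure (F \ {e}) := by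
  constructor
  · rintro ⟨𝒞, h𝒞, rfl⟩ e ⟨C, hC, heC⟩
    exact M.closure_subset_closure (Set.sdiff_subset_sdiff_left (Set.subset_sUnion_of_mem hC))
      ((h𝒞 C hC).mem_closure_sdiff_singleton_of_mem heC)
  · intro h
    refine ⟨{C | M.IsCircuit C ∧ C ⊆ F}, fun C hC => hC.1,
      Set.Subset.antisymm (fun e he => ?_) (Set.sUnion_subset fun C hC => hC.2)⟩
    obtain ⟨C, hCF, hC, heC⟩ := exists_isCircuit_of_mem_closure (h e he) (by simp)
    rw [Set.insert_sdiff_singleton, Set.insert_eq_of_mem he] at hCF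
    exact ⟨C, ⟨hC, hCF⟩, heC⟩

end Matroid

section LinearAlgebra

open Module Submodule

variable {k V ι : Type*} [Field k] [AddCommGroup V] [Module k V]

theorem surjective_pi_iff_linearIndependent [Finite ι] {φ : ι → Dual k V} :
    Function.Surjective (fun v i => φ i v) ↔ LinearIndependent k φ := by
  classical
  have := Fintype.ofFinite ι
  have h : Fintype.linearCombination k φ =
      (LinearMap.pi φ).dualMap ∘ₗ (dotProductEquiv k ι).toLinearMap := by
    ext i v
    simp [LinearMap.dualMap_apply, dotProduct, Pi.single_apply]
  rw [linearIndependent_iff_injective_fintypeLinearCombination]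
  change Function.Surjective (LinearMap.pi φ) ↔ _
  rw [← LinearMap.dualMap_injective_iff, h]
  simp

theorem mem_span_image_dual_iff [Finite ι] {φ : ι → Dual k V} {s : Set ι} {ψ : Dual k V} :
    ψ ∈ span k (φ '' s) ↔ ∀ v, (∀ i ∈ s, φ i v = 0) → ψ v = 0 := by
  refine ⟨fun h v hv => ?_, fun h => ?_⟩
  · have hle : span k (φ '' s) ≤ LinearMap.ker (Dual.eval k V v) :=
      span_le.mpr (Set.image_subset_iff.mpr hv)
    exact hle h
  · rw [Set.image_eq_range]
    refine mem_span_of_iInf_ker_le_ker fun v hv => h v fun i hi => ?_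
    exact (mem_iInf _).mp hv ⟨i, hi⟩

theorem span_image_dual_eq_top_iff [Finite ι] {φ : ι → Dual k V} {s : Set ι} :
    span k (φ '' s) = ⊤ ↔ ∀ v, (∀ i ∈ s, φ i v = 0) → v = 0 := by
  simp_rw [eq_top_iff', mem_span_image_dual_iff]
  simp only [← forall_dual_apply_eq_zero_iff k (_ : V)]
  exact ⟨fun h v hv ψ => h ψ v hv, fun h ψ v hv => h v hv ψ⟩

end LinearAlgebra

section Realization

open Submodule

variable {k : Type*} [Field k] {n : ℕ} {W : Submodule k (Fin n → k)} {M : Matroid (Fin n)}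

/-- The `i`-th coordinate function of `k^n` restricted to `W`, as a vector of `W^*`: the vectors
`coord W i` represent the matroid realized by `W`. -/
def coord (W : Submodule k (Fin n → k)) (i : Fin n) : Module.Dual k W :=
  LinearMap.proj i ∘ₗ W.subtype

theorem Realizes.subset_ground (hW : Realizes W M) (X : Set (Fin n)) : X ⊆ M.E :=
  hW.ground_eq ▸ Set.subset_univ X

theorem mem_perp_iff {q : Fin n → k} : q ∈ perp W ↔ ∑ i, q i • coord W i = 0 := by
  simp [LinearMap.ext_iff, perp, coord, mul_comm]

theorem perp_perp (W : Submodule k (Fin n → k)) : perp (perp W) = W := by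
  refine le_antisymm (fun v hv => ?_) fun p hp q hq => ?_
  · by_contra hvW
    obtain ⟨φ, hφv, hφ⟩ := exists_le_ker_of_notMem hvW
    obtain ⟨q, rfl⟩ := (dotProductEquiv k (Fin n)).surjective φ
    exact hφv (hv q fun p hp => (dotProduct_comm p q).trans (hφ hp))
  · exact (dotProduct_comm q p).trans (hq p hp)

theorem linearIndepOn_coord_iff {B : Set (Fin n)} :
    LinearIndepOn k (coord W) B ↔ ∀ q ∈ perp W, (∀ i ∈ Bᶜ, q i = 0) → q = 0 := by
  classical
  rw [← Set.coe_toFinset B, linearIndepOn_finset_iff]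
  simp_rw [mem_perp_iff, Set.coe_toFinset]
  refine ⟨fun h q hq hqB => ?_, fun h c hc i hi => ?_⟩
  · have hsum : ∑ i ∈ B.toFinset, q i • coord W i = 0 := by
      rw [← hq]
      refine Finset.sum_subset (Finset.subset_univ _) fun i _ hi => ?_
      rw [hqB i (by simpa using hi), zero_smul]
    funext i
    by_cases hi : i ∈ B
    · exact h q hsum i (Set.mem_toFinset.mpr hi)
    · exact hqB i hi
  · have hzero : B.indicator c = 0 := by
      refine h _ ?_ fun i hi => Set.indicator_of_notMem hi c
      simp_rw [← hc, Set.indicator_apply, ite_smul, zero_smul, ← Set.mem_toFinset (s := B)]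
      rw [Finset.sum_ite_mem, Finset.univ_inter]
    rw [← Set.indicator_of_mem (Set.mem_toFinset.mp hi) c, hzero, Pi.zero_apply]

theorem span_image_coord_eq_top_iff {B : Set (Fin n)} :
    span k (coord W '' B) = ⊤ ↔ ∀ p ∈ W, (∀ i ∈ B, p i = 0) → p = 0 := by
  simp [span_image_dual_eq_top_iff, coord]

theorem bijective_restrict_iff {B : Set (Fin n)} :
    Function.Bijective (fun (w : W) (b : B) => (w : Fin n → k) b) ↔
      (∀ p ∈ W, (∀ i ∈ B, p i = 0) → p = 0) ∧ ∀ q ∈ perp W, (∀ i ∈ Bᶜ, q i = 0) → q = 0 := by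
  rw [← linearIndepOn_coord_iff]
  refine and_congr ?_ (surjective_pi_iff_linearIndependent (φ := fun b : B => coord W b))
  refine (injective_iff_map_eq_zero (LinearMap.pi fun b : B => coord W b)).trans ?_
  simp [funext_iff, coord]

theorem Realizes.dual (hW : Realizes W M) : Realizes (perp W) M✶ where
  ground_eq := hW.ground_eq
  isBase_iff B := by
    rw [M.dual_isBase_iff (hW.subset_ground B), hW.ground_eq, ← Set.compl_eq_univ_sdiff,
      hW.isBase_iff, bijective_restrict_iff, bijective_restrict_iff, perp_perp, compl_compl,
      and_comm]

theorem Realizes.indep_iff (hW : Realizes W M) {I : Set (Fin n)} :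
    M.Indep I ↔ LinearIndepOn k (coord W) I := by
  refine ⟨fun hI => ?_, fun hI => ?_⟩
  · obtain ⟨B, hB, hIB⟩ := hI.exists_isBase_superset
    rw [hW.isBase_iff, bijective_restrict_iff, ← linearIndepOn_coord_iff] at hB
    exact hB.2.mono hIB
  · let B := hI.extend (Set.subset_univ I)
    have hspan : span k (coord W '' B) = ⊤ := by
      rw [hI.span_image_extend_eq_span_image, span_image_coord_eq_top_iff]
      exact fun p _ hp => funext fun i => hp i (Set.mem_univ i)
    have hB : M.IsBase B := by
      rw [hW.isBase_iff, bijective_restrict_iff, ← linearIndepOn_coord_iff,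
        ← span_image_coord_eq_top_iff]
      exact ⟨hspan, hI.linearIndepOn_extend _⟩
    exact hB.indep.subset (hI.subset_extend _)

theorem Realizes.mem_closure_iff (hW : Realizes W M) {X : Set (Fin n)} {i : Fin n} :
    i ∈ M.closure X ↔ coord W i ∈ span k (coord W '' X) := by
  obtain ⟨I, hI⟩ := M.exists_isBasis X (hW.subset_ground X)
  have hclosure (j : Fin n) : j ∈ M.closure I ↔ coord W j ∈ span k (coord W '' I) := by
    by_cases hj : j ∈ I
    · exact iff_of_true (M.mem_closure_of_mem hj hI.indep.subset_ground)
        (subset_span ⟨j, hj, rfl⟩)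
    · rw [← not_iff_not, hI.indep.notMem_closure_iff_of_notMem hj (hW.subset_ground {j} rfl),
        hW.indep_iff, linearIndepOn_insert hj, and_iff_right (hW.indep_iff.mp hI.indep)]
  have hspan : span k (coord W '' X) = span k (coord W '' I) := by
    refine le_antisymm (span_le.mpr ?_) (span_mono (Set.image_mono hI.subset))
    rintro _ ⟨j, hj, rfl⟩
    exact (hclosure j).mp (hI.subset_closure hj)
  rw [← hI.closure_eq_closure, hclosure, hspan]

theorem Realizes.isCyclicFlat_iff (hW : Realizes W M) {F : Set (Fin n)} :
    IsCyclicFlat M F ↔ M.IsFlat F ∧ M✶.IsFlat Fᶜ := by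
  have hF := hW.subset_ground F
  rw [Set.compl_eq_univ_sdiff, ← hW.ground_eq, isFlat_dual_diff_iff hF,
    ← exists_eq_sUnion_isCircuit_iff]
  exact ⟨fun h => ⟨h.isFlat, h.union_circuits⟩, fun h => ⟨h.1, h.2⟩⟩

end Realization

section Polynomial

open MvPolynomial

variable {k R τ : Type*} [Field k] [CommRing R] [Algebra k R]

attribute [local instance] MvPolynomial.algebraMvPolynomial in
theorem map_algebraMap_mul_eq_zero_iff {t : MvPolynomial τ k} {x : MvPolynomial τ R} :
    map (algebraMap k R) t * x = 0 ↔ t = 0 ∨ x = 0 := by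
  have : Module.Flat (MvPolynomial τ k) (MvPolynomial τ R) :=
    Module.Flat.isBaseChange k (MvPolynomial τ k) R _ Algebra.IsPushout.out
  exact smul_eq_zero (r := t) (m := x)

theorem map_mk_eq_zero_iff {𝔟 : Ideal R} {x : MvPolynomial τ R} :
    map (Ideal.Quotient.mk 𝔟) x = 0 ↔ x ∈ 𝔟.map (C : R →+* MvPolynomial τ R) := by
  rw [← RingHom.mem_ker, ker_map, Ideal.mk_ker]

theorem colon_map_C_eq (ε : R →ₐ[k] k) {𝔟 : Ideal R} {x : MvPolynomial τ R}
    (hx : x ∉ 𝔟.map (C : R →+* MvPolynomial τ R))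
    (h : (RingHom.ker ε).map (C : R →+* MvPolynomial τ R) ≤ (𝔟.map C).colon {x}) :
    (𝔟.map C).colon {x} = (RingHom.ker ε).map (C : R →+* MvPolynomial τ R) := by
  refine le_antisymm (fun s hs => ?_) h
  -- Modulo `ker ε` the polynomial `s` has coefficients in `k`, where it acts without torsion.
  let t : MvPolynomial τ k := map (ε : R →+* k) s
  have hker : (RingHom.ker ε).map C = RingHom.ker (map (σ := τ) (ε : R →+* k)) :=
    (ker_map (ε : R →+* k)).symm
  have hst : s - map (algebraMap k R) t ∈ (𝔟.map C).colon {x} := by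
    refine h (hker ▸ RingHom.mem_ker.mpr ?_)
    rw [map_sub, sub_eq_zero, map_map]
    have : (ε : R →+* k).comp (algebraMap k R) = RingHom.id k := ε.comp_algebraMap
    rw [this, map_id]
  have htx : map (algebraMap k (R ⧸ 𝔟)) t * map (Ideal.Quotient.mk 𝔟) x = 0 := by
    have hmem := Submodule.mem_colon_singleton.mp (sub_mem hs hst)
    rw [sub_sub_cancel, smul_eq_mul, ← map_mk_eq_zero_iff, map_mul, map_map] at hmem
    exact hmem
  rw [hker]
  exact (map_algebraMap_mul_eq_zero_iff.mp htx).resolve_right (map_mk_eq_zero_iff.not.mpr hx)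

end Polynomial

section SymmetricAlgebra

open SymmetricAlgebra

universe u

variable {k : Type*} {E : Type u} [Field k] [AddCommGroup E] [Module k E]

theorem ι_mem_span_iff {A : Set E} {u : E} :
    ι k E u ∈ Ideal.span (ι k E '' A) ↔ u ∈ Submodule.span k A := by
  refine ⟨fun h => ?_, fun h => ?_⟩
  · by_contra hu
    obtain ⟨φ, hφu, hφ⟩ := Submodule.exists_le_ker_of_notMem hu
    have hle : Ideal.span (ι k E '' A) ≤ RingHom.ker (lift φ) := by
      rw [Ideal.span_le]
      rintro _ ⟨a, ha, rfl⟩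
      simpa using hφ (Submodule.subset_span ha)
    exact hφu (by simpa using hle h)
  · have hle : Submodule.span k A ≤
        ((Ideal.span (ι k E '' A)).restrictScalars k).comap (ι k E) :=
      Submodule.span_le.mpr fun a ha => Ideal.subset_span ⟨a, ha, rfl⟩
    exact hle h

theorem span_ι_span (A : Set E) :
    Ideal.span (ι k E '' (Submodule.span k A : Set E)) = Ideal.span (ι k E '' A) := by
  refine le_antisymm (Ideal.span_le.mpr ?_)
    (Ideal.span_mono (Set.image_mono Submodule.subset_span))
  rintro _ ⟨u, hu, rfl⟩
  exact ι_mem_span_iff.mpr hu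

theorem ker_algebraMapInv :
    RingHom.ker (algebraMapInv : SymmetricAlgebra k E →ₐ[k] k) =
      Ideal.span (Set.range (ι k E)) := by
  set 𝔪 := Ideal.span (Set.range (ι k E))
  have hmk : (Algebra.ofId k _).comp algebraMapInv = Ideal.Quotient.mkₐ k 𝔪 := by
    refine algHom_ext (LinearMap.ext fun u => ?_)
    have hu : Ideal.Quotient.mk 𝔪 (ι k E u) = 0 :=
      Ideal.Quotient.eq_zero_iff_mem.mpr (Ideal.subset_span ⟨u, rfl⟩)
    simp [algebraMapInv, hu]
  refine le_antisymm (fun s hs => ?_) (Ideal.span_le.mpr ?_)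
  · have h := DFunLike.congr_fun hmk s
    rw [AlgHom.comp_apply, RingHom.mem_ker.mp hs, map_zero] at h
    exact Ideal.Quotient.eq_zero_iff_mem.mp h.symm
  · rintro _ ⟨u, rfl⟩
    exact algebraMapInv_ι u

theorem exists_algEquiv_mvPolynomial (U : Submodule k E) :
    ∃ (τ : Type u) (e : SymmetricAlgebra k E ≃ₐ[k] MvPolynomial τ (SymmetricAlgebra k U)),
      ∀ u : U, e (ι k E u) = MvPolynomial.C (ι k U u) := by
  obtain ⟨V, hUV⟩ := U.exists_isCompl
  let τ := Module.Basis.ofVectorSpaceIndex k V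
  let b : Module.Basis τ k V := Module.Basis.ofVectorSpace k V
  let φ : E →ₗ[k] MvPolynomial τ (SymmetricAlgebra k U) :=
    LinearMap.ofIsCompl hUV (Algebra.linearMap _ _ |>.restrictScalars k |>.comp (ι k U))
      (b.constr k MvPolynomial.X)
  have hφU (u : U) : φ u = MvPolynomial.C (ι k U u) := LinearMap.ofIsCompl_apply_left hUV u
  have hφb (i : τ) : φ (b i) = MvPolynomial.X i := by simp [φ]
  let ψ : MvPolynomial τ (SymmetricAlgebra k U) →ₐ[k] SymmetricAlgebra k E :=
    MvPolynomial.aevalTower (lift (ι k E ∘ₗ U.subtype)) fun i => ι k E (b i)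
  have hφψ : (lift φ).comp ψ = AlgHom.id k _ := by
    refine MvPolynomial.algHom_ext' (algHom_ext (LinearMap.ext fun u => ?_)) fun i => ?_
    · simp [ψ, hφU]
    · simp [ψ, hφb]
  have hψφ : ψ.comp (lift φ) = AlgHom.id k _ := by
    refine algHom_ext (LinearMap.ext_on_codisjoint hUV.codisjoint (fun u hu => ?_) ?_)
    · simp [ψ, hφU ⟨u, hu⟩]
    · have hb : ψ.toLinearMap ∘ₗ φ ∘ₗ V.subtype = ι k E ∘ₗ V.subtype :=
        b.ext fun i => by simp [ψ, hφb]
      exact fun v hv => by simpa using DFunLike.congr_fun hb ⟨v, hv⟩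
  exact ⟨τ, AlgEquiv.ofAlgHom (lift φ) ψ hφψ hψφ, fun u => by simp [hφU]⟩

section PolynomialOverSubspace

variable {U : Submodule k E} {τ : Type*}
  {e : SymmetricAlgebra k E ≃ₐ[k] MvPolynomial τ (SymmetricAlgebra k U)}

theorem map_span_ι_eq_map_C (he : ∀ u : U, e (ι k E u) = MvPolynomial.C (ι k U u)) :
    (Ideal.span (ι k E '' (U : Set E))).map e =
      (RingHom.ker (algebraMapInv : SymmetricAlgebra k U →ₐ[k] k)).map MvPolynomial.C := by
  rw [ker_algebraMapInv, Ideal.map_span, Ideal.map_span, Set.image_image, ← Set.range_comp,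
    Set.image_eq_range]
  exact congrArg _ (congrArg _ (funext he))

theorem exists_map_span_eq_map_C (he : ∀ u : U, e (ι k E u) = MvPolynomial.C (ι k U u))
    {A : Set (SymmetricAlgebra k E)} (hA : A ⊆ Algebra.adjoin k (ι k E '' (U : Set E))) :
    ∃ 𝔟 : Ideal (SymmetricAlgebra k U), (Ideal.span A).map e = 𝔟.map MvPolynomial.C := by
  have hadjoin : Algebra.adjoin k (ι k E '' (U : Set E)) ≤
      (IsScalarTower.toAlgHom k (SymmetricAlgebra k U)
        (MvPolynomial τ (SymmetricAlgebra k U))).range.comap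
          (e : SymmetricAlgebra k E →ₐ[k] MvPolynomial τ (SymmetricAlgebra k U)) := by
    refine Algebra.adjoin_le ?_
    rintro _ ⟨u, hu, rfl⟩
    exact ⟨ι k U ⟨u, hu⟩, (he ⟨u, hu⟩).symm⟩
  have hrange : e '' A ⊆ Set.range MvPolynomial.C := Set.image_subset_iff.mpr (hA.trans hadjoin)
  refine ⟨Ideal.span (MvPolynomial.C ⁻¹' (e '' A)), ?_⟩
  rw [Ideal.map_span, Ideal.map_span, Set.image_preimage_eq_of_subset hrange]

end PolynomialOverSubspace

theorem isPrime_span_ι (A : Set E) : (Ideal.span (ι k E '' A)).IsPrime := by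
  obtain ⟨τ, e, he⟩ := exists_algEquiv_mvPolynomial (Submodule.span k A)
  have hprime : ((Ideal.span (ι k E '' (Submodule.span k A : Set E))).map e).IsPrime := by
    rw [map_span_ι_eq_map_C he, ← MvPolynomial.ker_mapAlgHom]
    exact RingHom.ker_isPrime _
  rw [← span_ι_span, ← Ideal.comap_map_of_bijective e e.bijective (I := Ideal.span _)]
  exact hprime.comap e

theorem colon_eq_span_ι {U : Submodule k E} {A : Set (SymmetricAlgebra k E)}
    (hA : A ⊆ Algebra.adjoin k (ι k E '' (U : Set E))) {x : SymmetricAlgebra k E}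
    (hx : x ∉ Ideal.span A)
    (hU : Ideal.span (ι k E '' (U : Set E)) ≤ (Ideal.span A).colon {x}) :
    (Ideal.span A).colon {x} = Ideal.span (ι k E '' (U : Set E)) := by
  obtain ⟨τ, e, he⟩ := exists_algEquiv_mvPolynomial U
  obtain ⟨𝔟, h𝔟⟩ := exists_map_span_eq_map_C he hA
  have hmem (I : Ideal (SymmetricAlgebra k E)) (s : SymmetricAlgebra k E) :
      e s ∈ I.map e ↔ s ∈ I := by
    rw [← Ideal.mem_comap, Ideal.comap_map_of_bijective e e.bijective]
  have hcolon (s : SymmetricAlgebra k E) :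
      e s ∈ ((Ideal.span A).map e).colon {e x} ↔ s ∈ (Ideal.span A).colon {x} := by
    rw [Submodule.mem_colon_singleton, Submodule.mem_colon_singleton, smul_eq_mul, smul_eq_mul,
      ← map_mul, hmem]
  have hle : (Ideal.span (ι k E '' (U : Set E))).map e ≤
      ((Ideal.span A).map e).colon {e x} :=
    Ideal.map_le_iff_le_comap.mpr fun s hs => (hcolon s).mpr (hU hs)
  ext s
  rw [← hcolon, ← hmem (Ideal.span (ι k E '' _)), map_span_ι_eq_map_C he, h𝔟]
  rw [← hmem, h𝔟] at hx
  rw [map_span_ι_eq_map_C he, h𝔟] at hle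
  rw [colon_map_C_eq _ hx hle]

instance isNoetherianRing_symmetricAlgebra [FiniteDimensional k E] :
    IsNoetherianRing (SymmetricAlgebra k E) :=
  isNoetherianRing_of_ringEquiv _
    (equivMvPolynomial (Module.finBasis k E)).symm.toRingEquiv

end SymmetricAlgebra

section Colon

variable {R : Type*} [CommRing R]

theorem exists_colon_singleton_eq {𝔞 P : Ideal R} [IsNoetherianRing R]
    (hP : P ∈ associatedPrimes R (R ⧸ 𝔞)) : ∃ y, 𝔞.colon {y} = P := by
  obtain ⟨-, x, rfl⟩ := isAssociatedPrime_iff.mp hP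
  obtain ⟨y, rfl⟩ := Ideal.Quotient.mk_surjective x
  refine ⟨y, ?_⟩
  ext s
  rw [Submodule.mem_colon_singleton, Submodule.mem_colon_singleton, Submodule.mem_bot,
    ← Ideal.Quotient.eq_zero_iff_mem]
  rfl

theorem colon_singleton_eq_of_le_colon {𝔞 𝔟 : Ideal R} {h y : R} [(𝔞.colon {y}).IsPrime]
    (hle : 𝔞 ≤ 𝔟) (hh : h ∉ 𝔞.colon {y}) (h𝔟 : 𝔟 ≤ 𝔞.colon {h}) :
    𝔟.colon {y} = 𝔞.colon {y} := by
  refine le_antisymm (fun s hs => ?_) (Submodule.colon_mono hle subset_rfl)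
  have hsyh : s * y * h ∈ 𝔞 :=
    Submodule.mem_colon_singleton.mp (h𝔟 (Submodule.mem_colon_singleton.mp hs))
  have hsh : s * h ∈ 𝔞.colon {y} :=
    Submodule.mem_colon_singleton.mpr (by rwa [smul_eq_mul, mul_right_comm])
  exact (Ideal.IsPrime.mem_or_mem ‹_› hsh).resolve_right hh

end Colon

section Ideals

open Submodule

variable {k : Type*} [Field k] {n : ℕ} {W : Submodule k (Fin n → k)} {M : Matroid (Fin n)}
  {I J F G : Set (Fin n)} {P Q : Ideal (CoordRing W)} {i j : Fin n}

theorem fstCoord_mem_span_iff :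
    fstCoord W i ∈ span k (fstCoord W '' I ∪ sndCoord W '' J) ↔
      coord W i ∈ span k (coord W '' I) := by
  refine ⟨fun h => ?_, fun h => ?_⟩
  · have hle : span k (fstCoord W '' I ∪ sndCoord W '' J) ≤
        (span k (coord W '' I)).comap (LinearMap.inl k W (perp W)).dualMap := by
      rw [span_le, Set.union_subset_iff, Set.image_subset_iff, Set.image_subset_iff]
      exact ⟨fun j hj => subset_span ⟨j, hj, rfl⟩, fun j _ => zero_mem (span k (coord W '' I))⟩
    exact hle h
  · have hle : span k (coord W '' I) ≤
        (span k (fstCoord W '' I ∪ sndCoord W '' J)).comap (LinearMap.fst k W (perp W)).dualMap :=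
      span_le.mpr <| Set.image_subset_iff.mpr fun j hj => subset_span (Or.inl ⟨j, hj, rfl⟩)
    exact hle h

theorem sndCoord_mem_span_iff :
    sndCoord W j ∈ span k (fstCoord W '' I ∪ sndCoord W '' J) ↔
      coord (perp W) j ∈ span k (coord (perp W) '' J) := by
  refine ⟨fun h => ?_, fun h => ?_⟩
  · have hle : span k (fstCoord W '' I ∪ sndCoord W '' J) ≤
        (span k (coord (perp W) '' J)).comap (LinearMap.inr k W (perp W)).dualMap := by
      rw [span_le, Set.union_subset_iff, Set.image_subset_iff, Set.image_subset_iff]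
      exact ⟨fun i _ => zero_mem (span k (coord (perp W) '' J)),
        fun i hi => subset_span ⟨i, hi, rfl⟩⟩
    exact hle h
  · have hle : span k (coord (perp W) '' J) ≤
        (span k (fstCoord W '' I ∪ sndCoord W '' J)).comap (LinearMap.snd k W (perp W)).dualMap :=
      span_le.mpr <| Set.image_subset_iff.mpr fun i hi => subset_span (Or.inr ⟨i, hi, rfl⟩)
    exact hle h

theorem linIdeal_eq_span_ι (W : Submodule k (Fin n → k)) (I J : Set (Fin n)) :
    linIdeal W I J =
      Ideal.span (SymmetricAlgebra.ι k _ '' (fstCoord W '' I ∪ sndCoord W '' J)) := by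
  rw [linIdeal, Set.image_union, Ideal.span_union, Set.image_image, Set.image_image]
  rfl

instance isPrime_linIdeal (W : Submodule k (Fin n → k)) (I J : Set (Fin n)) :
    (linIdeal W I J).IsPrime :=
  linIdeal_eq_span_ι W I J ▸ isPrime_span_ι _

theorem linIdeal_le_iff :
    linIdeal W I J ≤ P ↔ I ⊆ {i | f W i ∈ P} ∧ J ⊆ {j | g W j ∈ P} := by
  rw [linIdeal, sup_le_iff, Ideal.span_le, Ideal.span_le, Set.image_subset_iff,
    Set.image_subset_iff]
  rfl

theorem Realizes.f_mem_linIdeal_iff (hW : Realizes W M) :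
    f W i ∈ linIdeal W I J ↔ i ∈ M.closure I := by
  rw [linIdeal_eq_span_ι, f, ι_mem_span_iff, fstCoord_mem_span_iff, hW.mem_closure_iff]

theorem Realizes.g_mem_linIdeal_iff (hW : Realizes W M) :
    g W j ∈ linIdeal W I J ↔ j ∈ M✶.closure J := by
  rw [linIdeal_eq_span_ι, g, ι_mem_span_iff, sndCoord_mem_span_iff, hW.dual.mem_closure_iff]

theorem Realizes.linIdeal_le_linIdeal_iff (hW : Realizes W M) :
    linIdeal W I J ≤ linIdeal W F G ↔ I ⊆ M.closure F ∧ J ⊆ M✶.closure G := by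
  simp_rw [linIdeal_le_iff, hW.f_mem_linIdeal_iff, hW.g_mem_linIdeal_iff, Set.ofPred_mem_eq]

theorem Realizes.isFlat_setOf_f_mem (hW : Realizes W M) (P : Ideal (CoordRing W)) :
    M.IsFlat {i | f W i ∈ P} := by
  refine Matroid.isFlat_iff_closure_eq.mpr
    (Set.Subset.antisymm (fun i hi => ?_) (M.subset_closure _ (hW.subset_ground _)))
  have hle : linIdeal W {i | f W i ∈ P} ∅ ≤ P :=
    linIdeal_le_iff.mpr ⟨subset_rfl, Set.empty_subset _⟩
  exact hle (hW.f_mem_linIdeal_iff.mpr hi)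

theorem Realizes.isFlat_setOf_g_mem (hW : Realizes W M) (P : Ideal (CoordRing W)) :
    M✶.IsFlat {j | g W j ∈ P} := by
  refine Matroid.isFlat_iff_closure_eq.mpr
    (Set.Subset.antisymm (fun j hj => ?_) (M✶.subset_closure _ (hW.subset_ground _)))
  have hle : linIdeal W ∅ {j | g W j ∈ P} ≤ P :=
    linIdeal_le_iff.mpr ⟨Set.empty_subset _, subset_rfl⟩
  exact hle (hW.g_mem_linIdeal_iff.mpr hj)

theorem mul_mem_pairs (W : Submodule k (Fin n → k)) (i : Fin n) : f W i * g W i ∈ pairs W :=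
  Ideal.subset_span ⟨i, rfl⟩

theorem mul_mem_linIdeal (hi : i ∈ I ∪ J) : f W i * g W i ∈ linIdeal W I J := by
  obtain ⟨hI, hJ⟩ := linIdeal_le_iff.mp (le_refl (linIdeal W I J))
  exact hi.elim (fun h => Ideal.mul_mem_right _ _ (hI h)) fun h => Ideal.mul_mem_left _ _ (hJ h)

theorem pairs_le_linIdeal (h : I ∪ J = Set.univ) : pairs W ≤ linIdeal W I J := by
  rw [pairs, Ideal.span_le]
  rintro _ ⟨i, rfl⟩
  exact mul_mem_linIdeal (h.ge (Set.mem_univ i))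

theorem setOf_f_mem_union_setOf_g_mem [P.IsPrime] (h : pairs W ≤ P) :
    {i | f W i ∈ P} ∪ {j | g W j ∈ P} = Set.univ :=
  Set.eq_univ_of_forall fun i => Ideal.IsPrime.mem_or_mem ‹_› (h (mul_mem_pairs W i))

theorem exists_notMem_linIdeal_le_colon (P : Ideal (CoordRing W)) [P.IsPrime] :
    ∃ h ∉ P, linIdeal W {i | g W i ∈ P}ᶜ {j | f W j ∈ P}ᶜ ≤ (pairs W).colon {h} := by
  classical
  let a := ∏ i with f W i ∉ P, f W i
  let b := ∏ i with g W i ∉ P, g W i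
  have ha : a ∉ P := by simp [a, Ideal.IsPrime.prod_mem_iff]
  have hb : b ∉ P := by simp [b, Ideal.IsPrime.prod_mem_iff]
  refine ⟨a * b, Ideal.IsPrime.mul_notMem ‹_› ha hb,
    linIdeal_le_iff.mpr ⟨fun i hi => ?_, fun i hi => ?_⟩⟩
  · have hdvd : g W i ∣ a * b :=
      (Finset.dvd_prod_of_mem (g W) (by simpa using hi)).mul_left a
    exact Submodule.mem_colon_singleton.mpr
      (Ideal.mem_of_dvd _ (mul_dvd_mul_left (f W i) hdvd) (mul_mem_pairs W i))
  · have hdvd : f W i ∣ a * b :=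
      (Finset.dvd_prod_of_mem (f W) (by simpa using hi)).mul_right b
    refine Submodule.mem_colon_singleton.mpr
      (Ideal.mem_of_dvd _ ?_ (mul_mem_pairs W i))
    rw [mul_comm, smul_eq_mul]
    exact mul_dvd_mul_left (g W i) hdvd

theorem pairs_sup_linIdeal (W : Submodule k (Fin n → k)) (I J : Set (Fin n)) :
    pairs W ⊔ linIdeal W I J =
      Ideal.span ((fun i => f W i * g W i) '' (I ∪ J)ᶜ ∪ (f W '' I ∪ g W '' J)) := by
  rw [Ideal.span_union, Ideal.span_union, ← linIdeal]
  refine le_antisymm (sup_le (Ideal.span_le.mpr ?_) le_sup_right)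
    (sup_le_sup_right (Ideal.span_mono (Set.image_subset_range _ _)) _)
  rintro _ ⟨i, rfl⟩
  by_cases hi : i ∈ I ∪ J
  · exact Ideal.mem_sup_right (mul_mem_linIdeal hi)
  · exact Ideal.mem_sup_left (Ideal.subset_span ⟨i, hi, rfl⟩)

theorem colon_pairs_sup_linIdeal {y : CoordRing W} (hIF : I ⊆ F) (hJG : J ⊆ G)
    (hFG : (I ∪ J)ᶜ ⊆ F ∩ G) (hy : y ∉ pairs W ⊔ linIdeal W I J)
    (hle : linIdeal W F G ≤ (pairs W ⊔ linIdeal W I J).colon {y}) :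
    (pairs W ⊔ linIdeal W I J).colon {y} = linIdeal W F G := by
  set U := span k (fstCoord W '' F ∪ sndCoord W '' G)
  have hf {i : Fin n} (hi : i ∈ F) :
      f W i ∈ Algebra.adjoin k (SymmetricAlgebra.ι k _ '' (U : Set (Module.Dual k _))) :=
    Algebra.subset_adjoin ⟨_, subset_span (Or.inl ⟨i, hi, rfl⟩), rfl⟩
  have hg {i : Fin n} (hi : i ∈ G) :
      g W i ∈ Algebra.adjoin k (SymmetricAlgebra.ι k _ '' (U : Set (Module.Dual k _))) :=
    Algebra.subset_adjoin ⟨_, subset_span (Or.inr ⟨i, hi, rfl⟩), rfl⟩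
  rw [linIdeal_eq_span_ι W F G, ← span_ι_span] at hle ⊢
  rw [pairs_sup_linIdeal] at hy hle ⊢
  refine colon_eq_span_ι ?_ hy hle
  rintro _ (⟨i, hi, rfl⟩ | ⟨i, hi, rfl⟩ | ⟨i, hi, rfl⟩)
  · exact mul_mem (hf (hFG hi).1) (hg (hFG hi).2)
  · exact hf (hIF hi)
  · exact hg (hJG hi)

theorem eq_linIdeal_of_colon_pairs_eq [P.IsPrime] {y : CoordRing W}
    (hy : (pairs W).colon {y} = P) : P = linIdeal W {i | f W i ∈ P} {j | g W j ∈ P} := by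
  obtain ⟨h, hh, hle⟩ := exists_notMem_linIdeal_le_colon P
  have hunion := setOf_f_mem_union_setOf_g_mem (hy ▸ Ideal.le_colon : pairs W ≤ P)
  set I := {i | f W i ∈ P}
  set J := {j | g W j ∈ P}
  have hIJ : Iᶜ ⊆ J := Set.compl_subset_iff_union.mpr hunion
  have hlocal : (pairs W ⊔ linIdeal W Jᶜ Iᶜ).colon {y} = P := by
    subst hy
    exact colon_singleton_eq_of_le_colon le_sup_left hh (sup_le Ideal.le_colon hle)
  have hmem : y ∉ pairs W ⊔ linIdeal W Jᶜ Iᶜ := fun hmem =>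
    Ideal.IsPrime.ne_top ‹_› (hlocal ▸ (colon_eq_top_iff_subset _).mpr
      (Set.singleton_subset_iff.mpr hmem))
  rw [← colon_pairs_sup_linIdeal (Set.compl_subset_comm.mp hIJ) hIJ ?_ hmem
    (hlocal.symm ▸ linIdeal_le_iff.mpr ⟨subset_rfl, subset_rfl⟩), hlocal]
  rw [Set.compl_union, compl_compl, compl_compl, Set.inter_comm]

theorem Realizes.exists_isBiflat (hW : Realizes W M)
    (hP : P ∈ associatedPrimes (CoordRing W) (CoordRing W ⧸ pairs W)) :
    ∃ F G : Set (Fin n), IsBiflat M F G ∧ P = linIdeal W F G := by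
  obtain ⟨y, hy⟩ := exists_colon_singleton_eq hP
  have := hP.isPrime
  have hle : pairs W ≤ P := hy ▸ Ideal.le_colon
  exact ⟨_, _, ⟨hW.isFlat_setOf_f_mem P, hW.isFlat_setOf_g_mem P,
    setOf_f_mem_union_setOf_g_mem hle⟩, eq_linIdeal_of_colon_pairs_eq hy⟩

theorem eq_linIdeal_of_mem_minimalPrimes (hP : P ∈ (pairs W).minimalPrimes)
    (h : I ∪ J = Set.univ) (hle : linIdeal W I J ≤ P) : P = linIdeal W I J :=
  le_antisymm (hP.2 ⟨isPrime_linIdeal W I J, pairs_le_linIdeal h⟩ hle) hle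

theorem Realizes.exists_isCyclicFlat (hW : Realizes W M) (hP : P ∈ (pairs W).minimalPrimes) :
    ∃ F, IsCyclicFlat M F ∧ P = linIdeal W F Fᶜ := by
  have : P.IsPrime := hP.1.1
  set I := {i | f W i ∈ P}
  set J := {j | g W j ∈ P}
  have hunion : I ∪ J = Set.univ := setOf_f_mem_union_setOf_g_mem hP.1.2
  have hIJ : Iᶜ ⊆ J := Set.compl_subset_iff_union.mpr hunion
  have hJI : Jᶜ ⊆ I := Set.compl_subset_comm.mp hIJ
  have hPI : P = linIdeal W I Iᶜ := eq_linIdeal_of_mem_minimalPrimes hP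
    (Set.union_compl_self I) (linIdeal_le_iff.mpr ⟨subset_rfl, hIJ⟩)
  have hPJ : P = linIdeal W Jᶜ J := eq_linIdeal_of_mem_minimalPrimes hP
    (Set.compl_union_self J) (linIdeal_le_iff.mpr ⟨hJI, subset_rfl⟩)
  have hcompl : Iᶜ = J := by
    refine hIJ.antisymm fun e heJ heI => ?_
    have hcl : e ∈ M.closure Jᶜ :=
      hW.f_mem_linIdeal_iff.mp (hPJ.le heI)
    have hcl_dual : e ∈ M✶.closure Iᶜ :=
      hW.g_mem_linIdeal_iff.mp (hPI.le heJ)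
    rw [mem_closure_dual_iff (hW.subset_ground {e} rfl) (not_not.mpr heI), hW.ground_eq,
      ← Set.compl_eq_univ_sdiff, compl_compl] at hcl_dual
    exact hcl_dual (M.closure_subset_closure
      (Set.subset_sdiff_singleton hJI (not_not.mpr heJ)) hcl)
  exact ⟨I, hW.isCyclicFlat_iff.mpr ⟨hW.isFlat_setOf_f_mem P,
    hcompl ▸ hW.isFlat_setOf_g_mem P⟩, hPI⟩

theorem Realizes.linIdeal_mem_minimalPrimes (hW : Realizes W M) (hF : IsCyclicFlat M F) :
    linIdeal W F Fᶜ ∈ (pairs W).minimalPrimes := by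
  obtain ⟨P, hP, hle⟩ := Ideal.exists_minimalPrimes_le
    (pairs_le_linIdeal (W := W) (Set.union_compl_self F))
  obtain ⟨F', -, rfl⟩ := hW.exists_isCyclicFlat hP
  obtain ⟨hflat, hflat'⟩ := hW.isCyclicFlat_iff.mp hF
  rw [hW.linIdeal_le_linIdeal_iff, hflat.closure, hflat'.closure, Set.compl_subset_compl] at hle
  exact hle.1.antisymm hle.2 ▸ hP

theorem Realizes.minimalPrimes_pairs (hW : Realizes W M) :
    (pairs W).minimalPrimes = {P | ∃ F, IsCyclicFlat M F ∧ P = linIdeal W F Fᶜ} := by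
  refine Set.Subset.antisymm (fun P hP => hW.exists_isCyclicFlat hP) ?_
  rintro _ ⟨F, hF, rfl⟩
  exact hW.linIdeal_mem_minimalPrimes hF

theorem Realizes.pairs_le_iff (hW : Realizes W M) [P.IsPrime] :
    pairs W ≤ P ↔ ∃ F, IsCyclicFlat M F ∧ linIdeal W F Fᶜ ≤ P := by
  constructor
  · intro h
    obtain ⟨Q, hQ, hle⟩ := Ideal.exists_minimalPrimes_le h
    obtain ⟨F, hF, rfl⟩ := hW.exists_isCyclicFlat hQ
    exact ⟨F, hF, hle⟩
  · rintro ⟨F, -, h⟩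
    exact (pairs_le_linIdeal (Set.union_compl_self F)).trans h

theorem Realizes.zeroLocus_pairs (hW : Realizes W M) :
    PrimeSpectrum.zeroLocus (pairs W : Set (CoordRing W)) =
      ⋃ F ∈ {F | IsCyclicFlat M F},
        PrimeSpectrum.zeroLocus (linIdeal W F Fᶜ : Set (CoordRing W)) := by
  ext P
  simp only [Set.mem_iUnion, PrimeSpectrum.mem_zeroLocus, SetLike.coe_subset_coe, exists_prop]
  exact hW.pairs_le_iff

theorem Realizes.pointLocus_pairs (hW : Realizes W M) :
    pointLocus W (pairs W) =
      ⋃ F ∈ {F | IsCyclicFlat M F}, (linSubspace W F Fᶜ : Set (W × perp W)) := by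
  ext x
  have := RingHom.ker_isPrime (evalAt W x)
  simp only [Set.mem_iUnion, exists_prop, ← pointLocus_linIdeal]
  exact hW.pairs_le_iff (P := RingHom.ker (evalAt W x))

theorem Realizes.eq_linIdeal_of_isPrimary (hW : Realizes W M) (hF : IsCyclicFlat M F)
    (hQ : Q.IsPrimary) (hle : pairs W ≤ Q) (hrad : Q.radical = linIdeal W F Fᶜ) :
    Q = linIdeal W F Fᶜ := by
  obtain ⟨h, hh, hmul⟩ := exists_notMem_linIdeal_le_colon (linIdeal W F Fᶜ)
  obtain ⟨hflat, hflat'⟩ := hW.isCyclicFlat_iff.mp hF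
  simp only [hW.f_mem_linIdeal_iff, hW.g_mem_linIdeal_iff, Set.ofPred_mem_eq, hflat.closure,
    hflat'.closure, compl_compl] at hmul
  refine le_antisymm (hrad ▸ Ideal.le_radical) fun s hs => ?_
  have hsQ : s * h ∈ Q := hle (Submodule.mem_colon_singleton.mp (hmul hs))
  exact ((Ideal.isPrimary_iff.mp hQ).2 hsQ).resolve_right (hrad ▸ hh)

theorem Realizes.eq_linIdeal_of_mem_decomposition (hW : Realizes W M) (hF : IsCyclicFlat M F)
    {t : Finset (Ideal (CoordRing W))} (ht : Submodule.IsMinimalPrimaryDecomposition (pairs W) t)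
    (hQ : Q ∈ t) (hrad : Q.radical = linIdeal W F Fᶜ) : Q = linIdeal W F Fᶜ :=
  hW.eq_linIdeal_of_isPrimary hF (ht.primary hQ)
    (ht.inf_eq.symm.trans_le (Finset.inf_le hQ)) hrad

end Ideals

end IdealOfPairs

open IdealOfPairs in
theorem theorem3p5 {k : Type*} [Field k] {n : ℕ} (M : Matroid (Fin n))
    (W : Submodule k (Fin n → k)) (hW : Realizes W M) :
    -- (a) associated primes
    (∀ P ∈ associatedPrimes (CoordRing W) (CoordRing W ⧸ pairs W),
      ∃ F G : Set (Fin n), IsBiflat M F G ∧ P = linIdeal W F G) ∧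
    -- (b) minimal primes, and the variety as a scheme-theoretic support and on `k`-points
    (pairs W).minimalPrimes = {P | ∃ F, IsCyclicFlat M F ∧ P = linIdeal W F Fᶜ} ∧
    PrimeSpectrum.zeroLocus (pairs W : Set (CoordRing W)) =
      ⋃ F ∈ {F | IsCyclicFlat M F},
        PrimeSpectrum.zeroLocus (linIdeal W F Fᶜ : Set (CoordRing W)) ∧
    pointLocus W (pairs W) =
      ⋃ F ∈ {F | IsCyclicFlat M F}, (linSubspace W F Fᶜ : Set (W × perp W)) ∧
    -- (c) primary components at the minimal primes
    (∃ t : Finset (Ideal (CoordRing W)),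
      Submodule.IsMinimalPrimaryDecomposition (pairs W) t) ∧
    (∀ F, IsCyclicFlat M F → ∀ t : Finset (Ideal (CoordRing W)),
      Submodule.IsMinimalPrimaryDecomposition (pairs W) t →
        linIdeal W F Fᶜ ∈ t ∧
          ∀ Q ∈ t, Q.radical = linIdeal W F Fᶜ → Q = linIdeal W F Fᶜ) := by
  refine ⟨fun P hP => hW.exists_isBiflat hP, hW.minimalPrimes_pairs, hW.zeroLocus_pairs,
    hW.pointLocus_pairs, ?_, fun F hF t ht => ⟨?_, fun Q hQ hrad => ?_⟩⟩
  · exact Submodule.IsLasker.exists_isMinimalPrimaryDecomposition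
      (Submodule.isLasker (CoordRing W) (CoordRing W)) (pairs W)
  · obtain ⟨Q, hQ, hrad⟩ :=
      Ideal.IsMinimalPrimaryDecomposition.minimalPrimes_subset_image_radical ht
        (hW.linIdeal_mem_minimalPrimes hF)
    exact hW.eq_linIdeal_of_mem_decomposition hF ht hQ hrad ▸ hQ
  · exact hW.eq_linIdeal_of_mem_decomposition hF ht hQ hrad
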